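/- Let $k$ be a field and let $H$ be a Hopf algebra over $k$ with bijective antipode $S$; write $\Delta(h)=h_{(1)}\otimes h_{(2)}$ for its coproduct and $\varepsilon$ for its counit. Let $A$ be a right $H$-comodule algebra, that is, a unital $k$-algebra with a coassociative and counital right coaction $\rho\colon A\to A\otimes H$, $\rho(a)=a_{(0)}\otimes a_{(1)}$, which is a unital algebra map, and let $B=\{a\in A:\rho(a)=a\otimes 1\}$ be its subalgebra of coinvariants. Assume that $A(B)^H$ is a Hopf Galois extension, i.e. that the canonical map $$\mathrm{can}\colon A\otimes_B A\to A\otimes H,\qquad a\otimes a'\mapsto a\,a'_{(0)}\otimes a'_{(1)},$$ is bijective, and that it is cleft by a convolution-invertible total integral $f\colon H\to A$: $f$ is $k$-linear, $f(1)=1$, $f(h)_{(0)}\otimes f(h)_{(1)}=f(h_{(1)})\otimes h_{(2)}$ for all $h\in H$, and there is a $k$-linear map $f^{-1}\colon H\to A$ with $f(h_{(1)})f^{-1}(h_{(2)})=\varepsilon(h)1=f^{-1}(h_{(1)})f(h_{(2)})$ for all $h\in H$. Let $[A,B]$ be the $k$-linear span of all $ab-ba$ with $a\in A$, $b\in B$,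 let $A_B=A/[A,B]$ be the quotient vector space, and write $\bar a$ for the class of $a\in A$. Then $$h\cdot\bar a=\overline{f(h_{(2)})\,a\,f^{-1}(h_{(1)})},\qquad \bar\rho(\bar a)=\overline{a_{(0)}}\otimes a_{(1)}$$ are well defined and make $A_B$ a left-right stable anti Yetter–Drinfeld module over $H$. That is, the first formula is a unital associative left $H$-action, the second is a coassociative counital right $H$-coaction, and, writing $\bar\rho(m)=m_{(0)}\otimes m_{(1)}$, for all $h\in H$ and $m\in A_B$ $$\bar\rho(h\cdot m)=h_{(2)}\cdot m_{(0)}\otimes h_{(3)}\,m_{(1)}\,S(h_{(1)})\qquad\text{and}\qquad m_{(1)}\cdot m_{(0)}=m .$$ -/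

import Mathlib

open scoped TensorProduct

noncomputable section

namespace HopfGalois

section Coactions

variable {k H M : Type*} [Field k] [Ring H] [HopfAlgebra k H] [AddCommGroup M] [Module k M]

/-- `ρ : M → M ⊗ H` is a (coassociative, counital) right `H`-comodule structure on `M`. -/
structure IsRightCoaction (ρ : M →ₗ[k] M ⊗[k] H) : Prop where
  coassoc : (TensorProduct.assoc k M H H).toLinearMap ∘ₗ ρ.rTensor H ∘ₗ ρ =
    (Coalgebra.comul (R := k) (A := H)).lTensor M ∘ₗ ρ
  counit : (TensorProduct.rid k M).toLinearMap ∘ₗ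
    (Coalgebra.counit (R := k) (A := H)).lTensor M ∘ₗ ρ = LinearMap.id

/-- For a left `H`-module structure `act` on `M`, the trilinear map sending `x ⊗ y ⊗ z` to the
operator `m ⊗ t ↦ (y · m) ⊗ z t S(x)` on `M ⊗ H`. -/
def aydOperator (act : H →ₐ[k] Module.End k M) :
    H ⊗[k] (H ⊗[k] H) →ₗ[k] Module.End k (M ⊗[k] H) :=
  TensorProduct.homTensorHomMap (.id k) M H M H ∘ₗ
    TensorProduct.map act.toLinearMap
      (TensorProduct.lift ((LinearMap.mul k (Module.End k H)).compl₁₂ (LinearMap.mul k H)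
        ((LinearMap.mul k H).flip ∘ₗ HopfAlgebra.antipode k))) ∘ₗ
    (TensorProduct.assoc k H H H).toLinearMap ∘ₗ (TensorProduct.comm k H (H ⊗[k] H)).toLinearMap

theorem aydOperator_tmul (act : H →ₐ[k] Module.End k M) (x y z t : H) (m : M) :
    aydOperator act (x ⊗ₜ (y ⊗ₜ z)) (m ⊗ₜ t) =
      act y m ⊗ₜ[k] (z * t * HopfAlgebra.antipode k x) := by
  simp [aydOperator, mul_assoc]

/-- `M`, with left `H`-action `act` (given as a unital algebra map `H → End(M)`) and right
`H`-coaction `ρ`, is a left-right stable anti Yetter-Drinfeld module: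
* `ρ (h m) = h₍₂₎ m₍₀₎ ⊗ h₍₃₎ m₍₁₎ S(h₍₁₎)`;
* `m₍₁₎ m₍₀₎ = m`. -/
structure IsLeftRightSAYD (act : H →ₐ[k] Module.End k M) (ρ : M →ₗ[k] M ⊗[k] H) : Prop where
  coaction : IsRightCoaction ρ
  antiYetterDrinfeld : ∀ (h : H) (m : M),
    ρ (act h m) = aydOperator act
      ((Coalgebra.comul (R := k) (A := H)).lTensor H (Coalgebra.comul (R := k) h)) (ρ m)
  stable : ∀ m : M, TensorProduct.lift act.toLinearMap.flip (ρ m) = m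

end Coactions

section Extensions

variable {k H A : Type*} [Field k] [Ring H] [HopfAlgebra k H] [Ring A] [Algebra k A]

/-- The subalgebra `B = {a | ρ a = a ⊗ 1}` of coinvariants of a comodule algebra. -/
def coinvariants (ρ : A →ₐ[k] A ⊗[k] H) : Subalgebra k A :=
  AlgHom.equalizer ρ Algebra.TensorProduct.includeLeft

theorem mem_coinvariants (ρ : A →ₐ[k] A ⊗[k] H) (a : A) :
    a ∈ coinvariants ρ ↔ ρ a = a ⊗ₜ[k] 1 := Iff.rfl

/-- The `k`-subspace of `A ⊗ A` spanned by all `ab ⊗ a' - a ⊗ ba'` with `b ∈ B`. -/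
def balancingRelations (B : Subalgebra k A) : Submodule k (A ⊗[k] A) :=
  Submodule.span k {t | ∃ a a' : A, ∃ b ∈ B, t = (a * b) ⊗ₜ[k] a' - a ⊗ₜ[k] (b * a')}

/-- The tensor product `A ⊗_B A` over a (not necessarily commutative) subalgebra `B` of `A`. -/
abbrev BalancedTensor (B : Subalgebra k A) : Type _ := (A ⊗[k] A) ⧸ balancingRelations B

/-- The map `A ⊗ A → A ⊗ H`, `a ⊗ a' ↦ a a'₍₀₎ ⊗ a'₍₁₎`. -/
def preCan (ρ : A →ₐ[k] A ⊗[k] H) : A ⊗[k] A →ₗ[k] A ⊗[k] H :=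
  TensorProduct.lift ((LinearMap.mul k (A ⊗[k] H)).compl₁₂
    (Algebra.TensorProduct.includeLeft : A →ₐ[k] A ⊗[k] H).toLinearMap ρ.toLinearMap)

theorem preCan_tmul (ρ : A →ₐ[k] A ⊗[k] H) (a a' : A) :
    preCan ρ (a ⊗ₜ a') = (a ⊗ₜ[k] 1) * ρ a' := by
  simp [preCan]

theorem balancingRelations_le_ker (ρ : A →ₐ[k] A ⊗[k] H) :
    balancingRelations (coinvariants ρ) ≤ LinearMap.ker (preCan ρ) := by
  refine Submodule.span_le.2 ?_
  rintro _ ⟨a, a', b, hb, rfl⟩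
  have hb' := (mem_coinvariants ρ b).1 hb
  simp [preCan_tmul, hb', ← mul_assoc]

/-- The canonical map `can : A ⊗_B A → A ⊗ H`, `a ⊗ a' ↦ a a'₍₀₎ ⊗ a'₍₁₎`,
where `B` is the subalgebra of coinvariants. -/
def can (ρ : A →ₐ[k] A ⊗[k] H) : BalancedTensor (coinvariants ρ) →ₗ[k] A ⊗[k] H :=
  (balancingRelations (coinvariants ρ)).liftQ (preCan ρ) (balancingRelations_le_ker ρ)

/-- The algebra map `ρ : A → A ⊗ H` makes `A` a right `H`-comodule algebra, and the extension
`B ⊆ A` of its coinvariants is Hopf Galois. -/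
structure IsHopfGaloisExtension (ρ : A →ₐ[k] A ⊗[k] H) : Prop where
  coaction : IsRightCoaction ρ.toLinearMap
  can_bijective : Function.Bijective (can ρ)

/-- `f : H → A` is a total integral: a unital map of right `H`-comodules. -/
structure IsTotalIntegral (ρ : A →ₐ[k] A ⊗[k] H) (f : H →ₗ[k] A) : Prop where
  unital : f 1 = 1
  colinear : ρ.toLinearMap ∘ₗ f = f.rTensor H ∘ₗ Coalgebra.comul

/-- `g` is the two-sided inverse of `f` in the convolution algebra `Hom(H, A)`. -/
structure IsConvolutionInverse (f g : H →ₗ[k] A) : Prop where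
  mul_inv : WithConv.toConv f * WithConv.toConv g = 1
  inv_mul : WithConv.toConv g * WithConv.toConv f = 1

/-- The `k`-subspace `[A, B]` of `A` spanned by all commutators `ab - ba` with `b ∈ B`. -/
def commutatorSubspace (B : Subalgebra k A) : Submodule k A :=
  Submodule.span k {c | ∃ a : A, ∃ b ∈ B, c = a * b - b * a}

/-- The quotient space `A_B = A / [A, B]`. -/
abbrev CommutatorQuotient (B : Subalgebra k A) : Type _ := A ⧸ commutatorSubspace B

/-- The element `f(h₍₂₎) a g(h₍₁₎)` of `A`. -/
def cleftAction (f g : H →ₗ[k] A) (h : H) (a : A) : A :=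
  TensorProduct.lift ((LinearMap.mul k A).flip.compl₁₂ (LinearMap.mulLeft k a ∘ₗ g) f)
    (Coalgebra.comul (R := k) h)

theorem cleftAction_eq_sum (f g : H →ₗ[k] A) (h : H) (a : A) {ι : Type*}
    (r : Coalgebra.Repr k h ι) :
    cleftAction f g h a = ∑ i ∈ r.index, f (r.right i) * a * g (r.left i) := by
  simp [cleftAction, ← r.eq, mul_assoc]

end Extensions

end HopfGalois

end

/-!
For an arbitrary Hopf Galois extension, `[r a l]` depends on `l ⊗ r` only through its class in
`A ⊗_B A`, so inverting `can` gives a map `A ⊗ H → Hom(A, A_B)` with `can(l ⊗ r) ↦ (a ↦ [r a l])`.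
Its values at `1 ⊗ h` are the Miyashita-Ulbrich action `h · [a]`, and, since `can(1 ⊗ r) = ρ(r)`,
this action satisfies `r₍₁₎ · [c r₍₀₎] = [r c]`; the case `c = 1` is stability. As `A ⊗ H` is
spanned by the elements `(l ⊗ 1) ρ(r)`, identities involving the action can be checked on these;
the anti Yetter-Drinfeld condition then becomes multiplicativity of `ρ` on `r a l`, after
`h₍₁₎ S(h₍₂₎) = ε(h)` has been cancelled. In the cleft case `f⁻¹(h₍₁₎) ⊗ f(h₍₂₎)` is a preimage
of `1 ⊗ h` under `can`.
-/

namespace HopfGalois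

noncomputable section

open Coalgebra HopfAlgebra LinearMap

section DiagonalAction

variable {k H M : Type*} [CommSemiring k] [Semiring H] [Bialgebra k H] [AddCommMonoid M]
  [Module k M]

/-- The diagonal action of `H` on `M ⊗ H`, `h · (m ⊗ t) = h₍₁₎ m ⊗ h₍₂₎ t`. -/
def diagonalAct (act : H →ₐ[k] Module.End k M) : H →ₗ[k] Module.End k (M ⊗[k] H) :=
  TensorProduct.homTensorHomMap (.id k) M H M H ∘ₗ
    TensorProduct.map act.toLinearMap (LinearMap.mul k H) ∘ₗ comul

theorem diagonalAct_tmul (act : H →ₐ[k] Module.End k M) (h t : H) (m : M) :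
    diagonalAct act h (m ⊗ₜ t) =
      TensorProduct.map (act.toLinearMap.flip m) (mulRight k t) (comul h) := by
  rw [← (ℛ k h).eq]
  simp [diagonalAct, ← (ℛ k h).eq]

end DiagonalAction

section Sandwich

variable {k A : Type*} [CommSemiring k] [Semiring A] [Algebra k A]

variable (k A) in
/-- The sandwich operators `l ⊗ r ↦ (a ↦ r a l)`; the factors are in the order of `can`, so the
left leg multiplies from the right. -/
def sandwich : A ⊗[k] A →ₗ[k] Module.End k A :=
  TensorProduct.lift ((LinearMap.mul k (Module.End k A)).compl₁₂
    (LinearMap.mul k A).flip (LinearMap.mul k A))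

@[simp]
theorem sandwich_tmul (l r a : A) : sandwich k A (l ⊗ₜ r) a = r * a * l := by
  simp [sandwich]

end Sandwich

section HopfModules

variable {k H M N : Type*} [Field k] [Ring H] [HopfAlgebra k H] [AddCommGroup M] [Module k M]
  [AddCommGroup N] [Module k N]

theorem IsRightCoaction.assoc_symm_lTensor_comul {δ : M →ₗ[k] M ⊗[k] H} (hδ : IsRightCoaction δ)
    (m : M) :
    (TensorProduct.assoc k M H H).symm (comul.lTensor M (δ m)) = δ.rTensor H (δ m) :=
  (LinearEquiv.symm_apply_eq _).2 (LinearMap.congr_fun hδ.coassoc m).symm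

theorem IsRightCoaction.of_surjective {δ : M →ₗ[k] M ⊗[k] H} {δ' : N →ₗ[k] N ⊗[k] H}
    (hδ : IsRightCoaction δ) {p : M →ₗ[k] N} (hp : Function.Surjective p)
    (h : δ' ∘ₗ p = p.rTensor H ∘ₗ δ) : IsRightCoaction δ' where
  coassoc := by
    rw [← cancel_right hp]
    calc (TensorProduct.assoc k N H H).toLinearMap ∘ₗ δ'.rTensor H ∘ₗ δ' ∘ₗ p
        = (TensorProduct.assoc k N H H).toLinearMap ∘ₗ (δ' ∘ₗ p).rTensor H ∘ₗ δ := by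
          rw [rTensor_comp, h, comp_assoc]
      _ = p.rTensor (H ⊗[k] H) ∘ₗ (TensorProduct.assoc k M H H).toLinearMap ∘ₗ
            δ.rTensor H ∘ₗ δ := by
          rw [h, rTensor_comp, rTensor_tensor]
          ext; simp
      _ = comul.lTensor N ∘ₗ δ' ∘ₗ p := by
          rw [hδ.coassoc, h, ← comp_assoc, ← comp_assoc, rTensor_comp_lTensor,
            lTensor_comp_rTensor]
  counit := by
    rw [← cancel_right hp]
    calc (TensorProduct.rid k N).toLinearMap ∘ₗ Coalgebra.counit.lTensor N ∘ₗ δ' ∘ₗ p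
        = p ∘ₗ (TensorProduct.rid k M).toLinearMap ∘ₗ Coalgebra.counit.lTensor M ∘ₗ δ := by
          rw [h, ← comp_assoc, ← comp_assoc, ← comp_assoc, ← comp_assoc]
          congr 1
          ext; simp
      _ = id ∘ₗ p := by rw [hδ.counit, comp_id, id_comp]

/-- The operators `m ⊗ t ↦ h₍₂₎ m ⊗ h₍₃₎ t S(h₍₁₎)` of the anti Yetter-Drinfeld condition. -/
def aydAct (act : H →ₐ[k] Module.End k M) : H →ₗ[k] Module.End k (M ⊗[k] H) :=
  aydOperator act ∘ₗ comul.lTensor H ∘ₗ comul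

theorem aydAct_tmul (act : H →ₐ[k] Module.End k M) {ι : Type*} {h : H} (r : Repr k h ι)
    (t : H) (m : M) :
    aydAct act h (m ⊗ₜ t) =
      ∑ i ∈ r.index, diagonalAct act (r.right i) (m ⊗ₜ (t * antipode k (r.left i))) := by
  have aydOperator_tmul_comul (g h : H) :
      aydOperator act (g ⊗ₜ comul h) (m ⊗ₜ t) = diagonalAct act h (m ⊗ₜ (t * antipode k g)) := by
    rw [diagonalAct_tmul, ← (ℛ k h).eq]
    simp [TensorProduct.tmul_sum, aydOperator_tmul, mul_assoc]
  simp [aydAct, ← r.eq, aydOperator_tmul_comul]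

theorem sum_aydAct_tmul_mul (act : H →ₐ[k] Module.End k M) {ι : Type*} {h : H}
    (r : Repr k h ι) (t : H) (m : M) :
    ∑ i ∈ r.index, aydAct act (r.right i) (m ⊗ₜ (t * r.left i)) =
      diagonalAct act h (m ⊗ₜ t) := by
  let D : H →ₗ[k] H →ₗ[k] M ⊗[k] H :=
    (diagonalAct act).flip ∘ₗ TensorProduct.mk k M H m ∘ₗ mulLeft k t
  have mul_antipode_comul :
      (LinearMap.mul' k H ∘ₗ (antipode k).lTensor H).rTensor H
        ((TensorProduct.assoc k H H H).symm (comul.lTensor H (comul h))) = 1 ⊗ₜ h := by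
    rw [coassoc_symm_apply, ← rTensor_comp_apply, comp_assoc, mul_antipode_lTensor_comul,
      rTensor_comp_apply, rTensor_counit_comul, rTensor_tmul, Algebra.linearMap_apply, map_one]
  calc ∑ i ∈ r.index, aydAct act (r.right i) (m ⊗ₜ (t * r.left i))
      = TensorProduct.lift D ((LinearMap.mul' k H ∘ₗ (antipode k).lTensor H).rTensor H
          ((TensorProduct.assoc k H H H).symm (comul.lTensor H (comul h)))) := by
        simp only [← r.eq, map_sum, lTensor_tmul]
        refine Finset.sum_congr rfl fun i _ => ?_
        rw [aydAct_tmul act (ℛ k (r.right i)), ← (ℛ k (r.right i)).eq]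
        simp [D, TensorProduct.tmul_sum, mul_assoc]
    _ = diagonalAct act h (m ⊗ₜ t) := by
        rw [mul_antipode_comul]
        simp [D]

end HopfModules

section GaloisExtensions

variable {k H A : Type*} [Field k] [Ring H] [HopfAlgebra k H] [Ring A] [Algebra k A]

theorem cleftAction_eq_sandwich (f g : H →ₗ[k] A) (h : H) (a : A) :
    cleftAction f g h a = sandwich k A (TensorProduct.map g f (comul h)) a := by
  rw [cleftAction_eq_sum f g h a (ℛ k h)]
  simp [← (ℛ k h).eq]

theorem mkQ_mul_comm {B : Subalgebra k A} (a : A) {b : A} (hb : b ∈ B) :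
    (commutatorSubspace B).mkQ (a * b) = (commutatorSubspace B).mkQ (b * a) :=
  (Submodule.Quotient.eq _).2 (Submodule.subset_span ⟨a, b, hb, rfl⟩)

theorem mkQ_sandwich_eq_zero {B : Subalgebra k A} {t : A ⊗[k] A} (ht : t ∈ balancingRelations B) :
    (commutatorSubspace B).mkQ ∘ₗ sandwich k A t = 0 := by
  suffices h : balancingRelations B ≤ ker ((commutatorSubspace B).mkQ.compRight k ∘ₗ sandwich k A)
    from h ht
  refine Submodule.span_le.2 ?_
  rintro _ ⟨l, r, b, hb, rfl⟩
  ext a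
  simpa [sub_eq_zero, mul_assoc] using mkQ_mul_comm (r * a * l) hb

variable {ρ : A →ₐ[k] A ⊗[k] H}

local notation "π" => Submodule.mkQ (commutatorSubspace (coinvariants ρ))

theorem preCan_surjective (hcan : Function.Surjective (can ρ)) :
    Function.Surjective (preCan ρ) :=
  hcan.comp (Submodule.mkQ_surjective _)

theorem preCan_induction (hcan : Function.Surjective (can ρ)) {P : A ⊗[k] H → Prop}
    (mul : ∀ l r, P (l ⊗ₜ 1 * ρ r)) (add : ∀ S T, P S → P T → P (S + T)) (T : A ⊗[k] H) : P T := by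
  obtain ⟨t, rfl⟩ := preCan_surjective hcan T
  induction t using TensorProduct.induction_on with
  | zero => simpa using mul 0 0
  | tmul l r => simpa only [preCan_tmul] using mul l r
  | add s t hs ht => simpa only [map_add] using add _ _ hs ht

/-- The map `A ⊗ H → Hom(A, A_B)` sending `can(l ⊗ r)` to `a ↦ [r a l]`. -/
def galoisSandwich (hcan : Function.Bijective (can ρ)) :
    A ⊗[k] H →ₗ[k] A →ₗ[k] CommutatorQuotient (coinvariants ρ) :=
  (balancingRelations (coinvariants ρ)).liftQ ((π).compRight k ∘ₗ sandwich k A)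
      (fun _ => mkQ_sandwich_eq_zero) ∘ₗ
    (LinearEquiv.ofBijective (can ρ) hcan).symm.toLinearMap

section Action

variable (hcan : Function.Bijective (can ρ))

theorem galoisSandwich_preCan (t : A ⊗[k] A) (a : A) :
    galoisSandwich hcan (preCan ρ t) a = π (sandwich k A t a) := by
  have can_symm : (LinearEquiv.ofBijective (can ρ) hcan).symm (preCan ρ t) =
      (balancingRelations (coinvariants ρ)).mkQ t :=
    (LinearEquiv.symm_apply_eq _).2 rfl
  rw [galoisSandwich, comp_apply, LinearEquiv.coe_coe, can_symm]
  rfl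

theorem galoisSandwich_tmul_one_mul_coaction (l r a : A) :
    galoisSandwich hcan (l ⊗ₜ 1 * ρ r) a = π (r * a * l) := by
  rw [← preCan_tmul, galoisSandwich_preCan, sandwich_tmul]

theorem galoisSandwich_coaction (r a : A) : galoisSandwich hcan (ρ r) a = π (r * a) := by
  simpa [← Algebra.TensorProduct.one_def] using galoisSandwich_tmul_one_mul_coaction hcan 1 r a

theorem galoisSandwich_tmul_one_mul (b : A) (T : A ⊗[k] H) (a : A) :
    galoisSandwich hcan (b ⊗ₜ 1 * T) a = galoisSandwich hcan T (a * b) := by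
  induction T using preCan_induction hcan.surjective with
  | mul l r =>
    rw [← mul_assoc, Algebra.TensorProduct.tmul_mul_tmul, one_mul]
    simp only [galoisSandwich_tmul_one_mul_coaction, mul_assoc]
  | add S T hS hT => simp only [mul_add, map_add, LinearMap.add_apply, hS, hT]

theorem galoisSandwich_mul_coaction (T : A ⊗[k] H) (b a : A) :
    galoisSandwich hcan (T * ρ b) a = galoisSandwich hcan T (b * a) := by
  induction T using preCan_induction hcan.surjective with
  | mul l r =>
    rw [mul_assoc, ← map_mul]
    simp only [galoisSandwich_tmul_one_mul_coaction, mul_assoc]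
  | add S T hS hT => simp only [add_mul, map_add, LinearMap.add_apply, hS, hT]

theorem galoisSandwich_tmul (b : A) (h : H) (a : A) :
    galoisSandwich hcan (b ⊗ₜ h) a = galoisSandwich hcan (1 ⊗ₜ h) (a * b) := by
  simp [← galoisSandwich_tmul_one_mul]

theorem galoisSandwich_mul_comm (h : H) (a : A) {b : A} (hb : b ∈ coinvariants ρ) :
    galoisSandwich hcan (1 ⊗ₜ h) (a * b) = galoisSandwich hcan (1 ⊗ₜ h) (b * a) := by
  rw [← galoisSandwich_tmul, ← galoisSandwich_mul_coaction, (mem_coinvariants ρ b).1 hb]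
  simp

/-- The Miyashita-Ulbrich action of `H` on `A_B`: `h · [a] = [r a l]` for `can(l ⊗ r) = 1 ⊗ h`,
first as a linear map. -/
def miyashitaUlbrichMap : H →ₗ[k] Module.End k (CommutatorQuotient (coinvariants ρ)) :=
  ((commutatorSubspace (coinvariants ρ)).liftQ
    (galoisSandwich hcan ∘ₗ TensorProduct.mk k A H 1).flip (Submodule.span_le.2 (by
      rintro _ ⟨a, b, hb, rfl⟩
      ext h
      simpa [sub_eq_zero] using galoisSandwich_mul_comm hcan h a hb))).flip

theorem miyashitaUlbrichMap_mkQ (h : H) (a : A) :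
    miyashitaUlbrichMap hcan h (π a) = galoisSandwich hcan (1 ⊗ₜ h) a := rfl

theorem galoisSandwich_one_tmul_mul (h : H) (T : A ⊗[k] H) (a : A) :
    galoisSandwich hcan (1 ⊗ₜ h * T) a =
      miyashitaUlbrichMap hcan h (galoisSandwich hcan T a) := by
  induction T using preCan_induction hcan.surjective with
  | mul l r =>
    calc galoisSandwich hcan (1 ⊗ₜ h * (l ⊗ₜ 1 * ρ r)) a
        = galoisSandwich hcan (l ⊗ₜ h * ρ r) a := by simp [← mul_assoc]
      _ = galoisSandwich hcan (1 ⊗ₜ h) (r * a * l) := by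
        rw [galoisSandwich_mul_coaction, galoisSandwich_tmul]
      _ = miyashitaUlbrichMap hcan h (galoisSandwich hcan (l ⊗ₜ 1 * ρ r) a) := by
        rw [galoisSandwich_tmul_one_mul_coaction, miyashitaUlbrichMap_mkQ]
  | add S T hS hT => simp only [mul_add, map_add, LinearMap.add_apply, hS, hT]

/-- The Miyashita-Ulbrich action of `H` on `A_B`: `h · [a] = [r a l]` for `can(l ⊗ r) = 1 ⊗ h`. -/
def miyashitaUlbrich : H →ₐ[k] Module.End k (CommutatorQuotient (coinvariants ρ)) :=
  AlgHom.ofLinearMap (miyashitaUlbrichMap hcan)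
    (by
      ext a
      simpa [Algebra.TensorProduct.one_def, -Submodule.mkQ_apply, miyashitaUlbrichMap_mkQ] using
        galoisSandwich_coaction hcan 1 a)
    (fun x y => by
      ext a
      simpa [-Submodule.mkQ_apply, miyashitaUlbrichMap_mkQ] using
        galoisSandwich_one_tmul_mul hcan x (1 ⊗ₜ y) a)

theorem miyashitaUlbrich_mkQ (h : H) (a : A) :
    miyashitaUlbrich hcan h (π a) = galoisSandwich hcan (1 ⊗ₜ h) a := rfl

end Action

theorem rTensor_mkQ_mul_comm {B : Subalgebra k A} (T : A ⊗[k] H) {b : A} (hb : b ∈ B) :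
    (commutatorSubspace B).mkQ.rTensor H (T * b ⊗ₜ 1) =
      (commutatorSubspace B).mkQ.rTensor H (b ⊗ₜ 1 * T) := by
  induction T using TensorProduct.induction_on with
  | zero => simp
  | tmul a h =>
    simp only [Algebra.TensorProduct.tmul_mul_tmul, mul_one, one_mul, rTensor_tmul,
      mkQ_mul_comm a hb]
  | add S T hS hT => simp only [add_mul, mul_add, map_add, hS, hT]

variable (ρ) in
/-- The coaction `[a] ↦ [a₍₀₎] ⊗ a₍₁₎` on `A_B`. -/
def quotientCoaction : CommutatorQuotient (coinvariants ρ) →ₗ[k]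
    CommutatorQuotient (coinvariants ρ) ⊗[k] H :=
  (commutatorSubspace (coinvariants ρ)).liftQ ((π).rTensor H ∘ₗ ρ.toLinearMap)
    (Submodule.span_le.2 (by
      rintro _ ⟨a, b, hb, rfl⟩
      simpa [sub_eq_zero, (mem_coinvariants ρ b).1 hb] using rTensor_mkQ_mul_comm (ρ a) hb))

theorem quotientCoaction_mkQ (a : A) : quotientCoaction ρ (π a) = (π).rTensor H (ρ a) := rfl

section AntiYetterDrinfeld

variable (hcan : Function.Bijective (can ρ))

theorem lift_miyashitaUlbrich_coaction (c r : A) :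
    TensorProduct.lift (miyashitaUlbrich hcan).toLinearMap.flip
      ((π ∘ₗ mulLeft k c).rTensor H (ρ r)) = π (r * c) := by
  rw [← galoisSandwich_coaction hcan]
  induction ρ r using TensorProduct.induction_on with
  | zero => simp
  | tmul b h => rw [galoisSandwich_tmul, ← miyashitaUlbrich_mkQ]; rfl
  | add S T hS hT => simp only [map_add, LinearMap.add_apply, hS, hT]

theorem lift_diagonalAct_coaction (hρ : IsRightCoaction ρ.toLinearMap) (c r : A) (x : H) :
    TensorProduct.lift (diagonalAct (miyashitaUlbrich hcan)).flip
      (((TensorProduct.mk k _ H).flip x ∘ₗ π ∘ₗ mulLeft k c).rTensor H (ρ r)) =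
      (π).rTensor H (ρ r * c ⊗ₜ x) := by
  let K : (A ⊗[k] H) ⊗[k] H →ₗ[k] CommutatorQuotient (coinvariants ρ) ⊗[k] H :=
    TensorProduct.map (TensorProduct.lift (miyashitaUlbrich hcan).toLinearMap.flip ∘ₗ
      (π ∘ₗ mulLeft k c).rTensor H) (mulRight k x)
  calc _ = K ((TensorProduct.assoc k A H H).symm (comul.lTensor A (ρ r))) := by
        induction ρ r using TensorProduct.induction_on with
        | zero => simp
        | tmul b h =>
          simp only [rTensor_tmul, TensorProduct.lift.tmul, comp_apply, flip_apply,
            TensorProduct.mk_apply, diagonalAct_tmul, lTensor_tmul]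
          rw [← (ℛ k h).eq]
          simp [K, TensorProduct.tmul_sum]
        | add S T hS hT => simp only [map_add, hS, hT]
    _ = K (ρ.toLinearMap.rTensor H (ρ r)) := congrArg K (hρ.assoc_symm_lTensor_comul r)
    _ = (π).rTensor H (ρ r * c ⊗ₜ x) := by
        induction ρ r using TensorProduct.induction_on with
        | zero => simp
        | tmul b h => simp [K, lift_miyashitaUlbrich_coaction]
        | add S T hS hT => simp only [map_add, add_mul, hS, hT]

/-- The pairing `(c ⊗ x, a ⊗ h) ↦ h₍₂₎ [c a₍₀₎] ⊗ h₍₃₎ x a₍₁₎ S(h₍₁₎)`, through which the coaction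
of `A_B` is computed on the values of `galoisSandwich`. -/
def aydPairing : A ⊗[k] H →ₗ[k] A ⊗[k] H →ₗ[k] CommutatorQuotient (coinvariants ρ) ⊗[k] H :=
  TensorProduct.uncurry (.id k) A H _ ∘ₗ
    ((LinearMap.mul k (A ⊗[k] H)).compl₂ ρ.toLinearMap).compr₂
      ((aydAct (miyashitaUlbrich hcan)).flip ∘ₗ (π).rTensor H)

theorem aydPairing_tmul (Y : A ⊗[k] H) (a : A) (h : H) :
    aydPairing hcan Y (a ⊗ₜ h) =
      aydAct (miyashitaUlbrich hcan) h ((π).rTensor H (Y * ρ a)) := rfl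

theorem aydPairing_tmul_one_mul (Y : A ⊗[k] H) (l : A) (T : A ⊗[k] H) :
    aydPairing hcan Y (l ⊗ₜ 1 * T) = aydPairing hcan (Y * ρ l) T := by
  induction T using TensorProduct.induction_on with
  | zero => simp
  | tmul b h => simp [aydPairing_tmul, mul_assoc]
  | add S T hS hT => simp only [mul_add, map_add, hS, hT]

theorem aydPairing_tmul_coaction (hρ : IsRightCoaction ρ.toLinearMap) (c r : A) (x : H) :
    aydPairing hcan (c ⊗ₜ x) (ρ r) = (π).rTensor H (ρ r * c ⊗ₜ x) := by
  let F : (A ⊗[k] H) ⊗[k] H →ₗ[k] CommutatorQuotient (coinvariants ρ) ⊗[k] H :=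
    TensorProduct.lift (aydAct (miyashitaUlbrich hcan)).flip ∘ₗ
      ((π).rTensor H ∘ₗ mulLeft k (c ⊗ₜ x)).rTensor H
  calc aydPairing hcan (c ⊗ₜ x) (ρ r)
      = F (ρ.toLinearMap.rTensor H (ρ r)) := by
        induction ρ r using TensorProduct.induction_on with
        | zero => simp
        | tmul b h => rfl
        | add S T hS hT => simp only [map_add, hS, hT]
    _ = F ((TensorProduct.assoc k A H H).symm (comul.lTensor A (ρ r))) :=
        congrArg F (hρ.assoc_symm_lTensor_comul r).symm
    _ = TensorProduct.lift (diagonalAct (miyashitaUlbrich hcan)).flip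
          (((TensorProduct.mk k _ H).flip x ∘ₗ π ∘ₗ mulLeft k c).rTensor H (ρ r)) := by
        induction ρ r using TensorProduct.induction_on with
        | zero => simp
        | tmul b h =>
          simp only [rTensor_tmul, TensorProduct.lift.tmul, comp_apply, flip_apply,
            TensorProduct.mk_apply, lTensor_tmul]
          rw [← sum_aydAct_tmul_mul _ (ℛ k h), ← (ℛ k h).eq]
          simp [F, TensorProduct.tmul_sum]
        | add S T hS hT => simp only [map_add, hS, hT]
    _ = (π).rTensor H (ρ r * c ⊗ₜ x) := lift_diagonalAct_coaction hcan hρ c r x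

theorem aydPairing_coaction (hρ : IsRightCoaction ρ.toLinearMap) (Y : A ⊗[k] H) (r : A) :
    aydPairing hcan Y (ρ r) = (π).rTensor H (ρ r * Y) := by
  induction Y using TensorProduct.induction_on with
  | zero => simp
  | tmul c x => exact aydPairing_tmul_coaction hcan hρ c r x
  | add Y Z hY hZ => simp only [mul_add, map_add, LinearMap.add_apply, hY, hZ]

theorem quotientCoaction_galoisSandwich (hρ : IsRightCoaction ρ.toLinearMap)
    (T : A ⊗[k] H) (a : A) :
    quotientCoaction ρ (galoisSandwich hcan T a) = aydPairing hcan (ρ a) T := by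
  induction T using preCan_induction hcan.surjective with
  | mul l r =>
    rw [galoisSandwich_tmul_one_mul_coaction, quotientCoaction_mkQ, aydPairing_tmul_one_mul,
      aydPairing_coaction hcan hρ, map_mul ρ, map_mul ρ, mul_assoc]
  | add S T hS hT => simp only [map_add, LinearMap.add_apply, hS, hT]

end AntiYetterDrinfeld

theorem isLeftRightSAYD_miyashitaUlbrich (hρ : IsHopfGaloisExtension ρ) :
    IsLeftRightSAYD (miyashitaUlbrich hρ.can_bijective) (quotientCoaction ρ) where
  coaction := hρ.coaction.of_surjective (Submodule.mkQ_surjective _) rfl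
  antiYetterDrinfeld h m := by
    obtain ⟨a, rfl⟩ := Submodule.mkQ_surjective _ m
    rw [miyashitaUlbrich_mkQ, quotientCoaction_galoisSandwich _ hρ.coaction, aydPairing_tmul,
      map_one, mul_one]
    rfl
  stable m := by
    obtain ⟨a, rfl⟩ := Submodule.mkQ_surjective _ m
    simpa only [quotientCoaction_mkQ, mulLeft_one, comp_id, mul_one] using
      lift_miyashitaUlbrich_coaction hρ.can_bijective 1 a

theorem preCan_map_comul {f g : H →ₗ[k] A} (hf : ρ.toLinearMap ∘ₗ f = f.rTensor H ∘ₗ comul)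
    (hgf : WithConv.toConv g * WithConv.toConv f = 1) (h : H) :
    preCan ρ (TensorProduct.map g f (comul h)) = 1 ⊗ₜ h := by
  let conv : H ⊗[k] H →ₗ[k] A := mul' k A ∘ₗ TensorProduct.map g f
  have conv_comul : conv ∘ₗ comul = Algebra.linearMap k A ∘ₗ Coalgebra.counit :=
    WithConv.toConv_injective hgf
  have preCan_tmul_apply (x y : H) : preCan ρ (g x ⊗ₜ f y) =
      conv.rTensor H ((TensorProduct.assoc k H H H).symm (x ⊗ₜ comul y)) := by
    have hfy : ρ (f y) = f.rTensor H (comul y) := LinearMap.congr_fun hf y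
    rw [preCan_tmul, hfy, ← (ℛ k y).eq]
    simp [conv, TensorProduct.tmul_sum, Finset.mul_sum]
  calc preCan ρ (TensorProduct.map g f (comul h))
      = conv.rTensor H ((TensorProduct.assoc k H H H).symm (comul.lTensor H (comul h))) := by
        simp only [← (ℛ k h).eq, map_sum, TensorProduct.map_tmul, lTensor_tmul,
          preCan_tmul_apply]
    _ = (Algebra.linearMap k A).rTensor H (Coalgebra.counit.rTensor H (comul h)) := by
        rw [coassoc_symm_apply, ← rTensor_comp_apply, conv_comul, rTensor_comp_apply]
    _ = 1 ⊗ₜ h := by simp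

end GaloisExtensions

end

end HopfGalois

open HopfGalois in
theorem proposition3p12_general {k H A : Type*} [Field k] [Ring H] [HopfAlgebra k H]
    [Ring A] [Algebra k A] (ρ : A →ₐ[k] A ⊗[k] H) (hρ : IsHopfGaloisExtension ρ) :
    ∃ (act : H →ₐ[k] Module.End k (CommutatorQuotient (coinvariants ρ)))
      (ρB : CommutatorQuotient (coinvariants ρ) →ₗ[k]
        CommutatorQuotient (coinvariants ρ) ⊗[k] H),
      (∀ (h : H) (t : A ⊗[k] A), preCan ρ t = 1 ⊗ₜ h → ∀ a : A,
        act h ((commutatorSubspace (coinvariants ρ)).mkQ a) =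
          (commutatorSubspace (coinvariants ρ)).mkQ (sandwich k A t a)) ∧
      (∀ a : A, ρB ((commutatorSubspace (coinvariants ρ)).mkQ a) =
        (commutatorSubspace (coinvariants ρ)).mkQ.rTensor H (ρ a)) ∧
      IsLeftRightSAYD act ρB :=
  ⟨miyashitaUlbrich hρ.can_bijective, quotientCoaction ρ,
    fun h t ht a => by rw [miyashitaUlbrich_mkQ, ← ht, galoisSandwich_preCan],
    quotientCoaction_mkQ, isLeftRightSAYD_miyashitaUlbrich hρ⟩

theorem proposition3p12 {k H A : Type*} [Field k] [Ring H] [HopfAlgebra k H]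
    [Ring A] [Algebra k A]
    (hS : Function.Bijective (HopfAlgebra.antipode k : H →ₗ[k] H))
    (ρ : A →ₐ[k] A ⊗[k] H) (hρ : HopfGalois.IsHopfGaloisExtension ρ)
    (f finv : H →ₗ[k] A) (hf : HopfGalois.IsTotalIntegral ρ f)
    (hfinv : HopfGalois.IsConvolutionInverse f finv) :
    ∃ (act : H →ₐ[k] Module.End k
        (HopfGalois.CommutatorQuotient (HopfGalois.coinvariants ρ)))
      (ρB : HopfGalois.CommutatorQuotient (HopfGalois.coinvariants ρ) →ₗ[k]
        HopfGalois.CommutatorQuotient (HopfGalois.coinvariants ρ) ⊗[k] H),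
      (∀ (h : H) (a : A),
        act h ((HopfGalois.commutatorSubspace (HopfGalois.coinvariants ρ)).mkQ a) =
          (HopfGalois.commutatorSubspace (HopfGalois.coinvariants ρ)).mkQ
            (HopfGalois.cleftAction f finv h a)) ∧
      (∀ a : A,
        ρB ((HopfGalois.commutatorSubspace (HopfGalois.coinvariants ρ)).mkQ a) =
          (HopfGalois.commutatorSubspace (HopfGalois.coinvariants ρ)).mkQ.rTensor H (ρ a)) ∧
      HopfGalois.IsLeftRightSAYD act ρB := by
  obtain ⟨act, ρB, hact, hρB⟩ := proposition3p12_general ρ hρ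
  exact ⟨act, ρB, fun h a => by rw [HopfGalois.cleftAction_eq_sandwich,
    hact h _ (HopfGalois.preCan_map_comul hf.colinear hfinv.inv_mul h)], hρB⟩
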